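/- Let $n\ge 1$, $\beta,\rho>0$, and $p(x)=\beta\|x\|_1+\rho\,g(x)$ with $g(x)=\sum_{1\le i<j\le n}|x_i-x_j|$ for $x\in\mathbb R^n$. For a convex function $f:\mathbb R^n\to\mathbb R$ put $\mathrm{Prox}_f(y)=\operatorname{argmin}_{x}\{\frac12\|x-y\|^2+f(x)\}$, and let $S_\rho=\mathrm{Prox}_{\rho g}$. Let $B\in\mathbb R^{(n-1)\times n}$ be the matrix with $Bx=(x_1-x_2,\dots,x_{n-1}-x_n)$, let $D=\{x: Bx\ge 0\}$, and let $\Pi_D$ be the metric projection onto $D$. For $z\in\mathbb R^n$ let $\mathcal K_D(z)$ be the family of all $K\subseteq\{1,\dots,n-1\}$ such that $B_K$ (the rows of $B$ indexed by $K$) has full row rank, $(B\Pi_D(z))_i=0$ for all $i\in K$, and $\operatorname{supp}(\lambda)\subseteq K$ for some $\lambda\in\mathbb R^{n-1}$ satisfying the KKT system $\Pi_D(z)-z+B^T\lambda=0$, $B\Pi_D(z)\ge0$, $\lambda\le 0$, $\lambda^TB\Pi_D(z)=0$. The HS-Jacobian of $\Pi_D$ at $z$ is $\mathcal Q_D(z)=\{I_n-B_K^T(B_KB_K^T)^{-1}B_K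 : K\in\mathcal K_D(z)\}$. Let $w\in\mathbb R^n$ with $w_k=n-2k+1$, and for each $y\in\mathbb R^n$ fix any permutation matrix $P_y$ such that $P_yy$ is sorted in non-increasing order. Put $\mathcal Q_{S_\rho}(y)=\{P_y^T\widehat QP_y:\widehat Q\in\mathcal Q_D(P_yy-\rho w)\}$ and $$\mathcal M(y)=\{M\in\mathbb R^{n\times n} : M=M^T,\ M=\Theta Q,\ \Theta\in\partial_B\mathrm{Prox}_{\beta\|\cdot\|_1}(S_\rho(y)),\ Q\in\mathcal Q_{S_\rho}(y)\},$$ where $\partial_B F(\eta)$, the B-subdifferential, is the set of all limits of Jacobian matrices $F'(\eta^k)$ along sequences $\eta^k\to\eta$ of points at which $F$ is differentiable. Then the multifunction $\mathcal M$ is nonempty-valued, compact-valued and upper semicontinuous on $\mathbb R^n$. For every $y$ and every $M\in\mathcal M(y)$, both $M$ and $I_n-M$ are symmetric and positive semidefinite. Every $y\in\mathbb R^n$ has a neighborhood $\mathcal Y$ such that for all $u\in\mathcal Y$ and all $M\in\mathcal M(u)$, $$\mathrm{Prox}_p(u)-\mathrm{Prox}_p(y)-M(u-y)=0.$$ Moreover,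 for every $\gamma>0$, $\mathrm{Prox}_p$ is $\gamma$-order semismooth on $\mathbb R^n$ with respect to $\mathcal M$: it is locally Lipschitz, $\mathcal M$ is nonempty-valued, compact-valued and upper semicontinuous, and at every $y$ the map $\mathrm{Prox}_p$ is directionally differentiable and $\mathrm{Prox}_p(y+h)-\mathrm{Prox}_p(y)-Mh=O(\|h\|^{1+\gamma})$ as $h\to0$, uniformly in $M\in\mathcal M(y+h)$. -/

import Mathlib

open Filter Topology
open scoped Matrix

noncomputable section

namespace ClusteredLasso

/-- Euclidean `n`-space. -/
abbrev Vec (n : ℕ) : Type := EuclideanSpace ℝ (Fin n)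

/-- The product of a matrix with a vector of Euclidean space. -/
def act {m n : ℕ} (A : Matrix (Fin m) (Fin n) ℝ) (x : Vec n) : Vec m :=
  WithLp.toLp 2 (A *ᵥ x.ofLp)

/-- The minimizer of `φ` over `C`. (It is used below only for strongly convex problems with a closed
convex nonempty constraint set, where there is exactly one minimizer.) -/
def argmin {X : Type*} [Nonempty X] (C : Set X) (φ : X → ℝ) : X :=
  Classical.epsilon fun x => x ∈ C ∧ IsMinOn φ C x

/-- The proximal mapping of a real-valued function. -/
def prox {n : ℕ} (f : Vec n → ℝ) (y : Vec n) : Vec n :=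
  argmin Set.univ fun x => (1 / 2) * ‖x - y‖ ^ 2 + f x

/-- The metric projection onto a set. -/
def proj {n : ℕ} (C : Set (Vec n)) (y : Vec n) : Vec n :=
  argmin C fun x => ‖x - y‖

/-- `‖x‖₁`. -/
def l1 {n : ℕ} (x : Vec n) : ℝ := ∑ i, |x i|

/-- `g(x) = ∑_{i < j} |x_i - x_j|`. -/
def pairDiff {n : ℕ} (x : Vec n) : ℝ := ∑ i, ∑ j ∈ Finset.Ioi i, |x i - x j|

/-- The clustered lasso regularizer `p(x) = β ‖x‖₁ + ρ ∑_{i < j} |x_i - x_j|`. -/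
def regularizer {n : ℕ} (β ρ : ℝ) (x : Vec n) : ℝ := β * l1 x + ρ * pairDiff x

/-- `S_ρ`, the proximal mapping of `ρ g`. -/
def S {n : ℕ} (ρ : ℝ) : Vec n → Vec n := prox fun x => ρ * pairDiff x

/-- The `(n-1) × n` matrix `B` with `B x = (x_1 - x_2, …, x_{n-1} - x_n)`. -/
def diffMatrix (n : ℕ) : Matrix (Fin (n - 1)) (Fin n) ℝ :=
  Matrix.of fun i j => if j.val = i.val then 1 else if j.val = i.val + 1 then -1 else 0

/-- The cone `D = {x | B x ≥ 0}`. -/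
def cone (n : ℕ) : Set (Vec n) := {x | ∀ i, 0 ≤ (diffMatrix n *ᵥ x.ofLp) i}

/-- The vector `w` with `w_k = n - 2k + 1` for `k = 1, …, n` (here `k = i + 1`). -/
def weight (n : ℕ) : Vec n := WithLp.toLp 2 fun i => (n : ℝ) - 2 * ((i.val : ℝ) + 1) + 1

/-- The set of KKT multipliers of the projection of `y` onto `D`. -/
def multipliers {n : ℕ} (y : Vec n) : Set (Fin (n - 1) → ℝ) :=
  {l | (proj (cone n) y).ofLp - y.ofLp + (diffMatrix n)ᵀ *ᵥ l = 0 ∧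
    (∀ i, 0 ≤ (diffMatrix n *ᵥ (proj (cone n) y).ofLp) i) ∧
    (∀ i, l i ≤ 0) ∧
    l ⬝ᵥ (diffMatrix n *ᵥ (proj (cone n) y).ofLp) = 0}

/-- The active index set of the projection of `y` onto `D`. -/
def activeSet {n : ℕ} (y : Vec n) : Set (Fin (n - 1)) :=
  {i | (diffMatrix n *ᵥ (proj (cone n) y).ofLp) i = 0}

/-- `B_K`, the rows of `B` indexed by `K`. -/
def rowsOf (n : ℕ) (K : Finset (Fin (n - 1))) : Matrix K (Fin n) ℝ :=
  (diffMatrix n).submatrix Subtype.val id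

/-- The index sets `K` with `supp λ ⊆ K ⊆ I_D(y)` for some multiplier `λ` and `B_K` of full row
rank. -/
def indexSets {n : ℕ} (y : Vec n) : Set (Finset (Fin (n - 1))) :=
  {K | (∃ l ∈ multipliers y, Function.support l ⊆ (K : Set (Fin (n - 1)))) ∧
    (K : Set (Fin (n - 1))) ⊆ activeSet y ∧
    LinearIndependent ℝ (rowsOf n K).row}

/-- The generalized HS-Jacobian of the projection onto `D` at `y`. -/
def hsJacobian {n : ℕ} (y : Vec n) : Set (Matrix (Fin n) (Fin n) ℝ) :=
  {Q | ∃ K ∈ indexSets y,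
    Q = 1 - (rowsOf n K)ᵀ * (rowsOf n K * (rowsOf n K)ᵀ)⁻¹ * rowsOf n K}

/-- The permutation matrix `P_y` belonging to a choice `σ` of a permutation for every `y`. -/
def permMat {n : ℕ} (σ : Vec n → Equiv.Perm (Fin n)) (y : Vec n) : Matrix (Fin n) (Fin n) ℝ :=
  (σ y).permMatrix ℝ

/-- `σ` chooses, for every `y`, a permutation whose matrix `P_y` sorts `y` in non-increasing
order. -/
def IsSorting {n : ℕ} (σ : Vec n → Equiv.Perm (Fin n)) : Prop :=
  ∀ y, Antitone (permMat σ y *ᵥ y.ofLp)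

/-- The matrices `P_yᵀ Q̂ P_y` with `Q̂` in the HS-Jacobian at `P_y y - ρ w`. -/
def jacS {n : ℕ} (ρ : ℝ) (σ : Vec n → Equiv.Perm (Fin n)) (y : Vec n) :
    Set (Matrix (Fin n) (Fin n) ℝ) :=
  {Q | ∃ Q' ∈ hsJacobian (act (permMat σ y) y - ρ • weight n),
    Q = (permMat σ y)ᵀ * Q' * permMat σ y}

/-- The B-subdifferential of `f` at `x`: all limits of Jacobian matrices of `f` along sequences of
points of differentiability that converge to `x`. -/
def bSubdifferential {n : ℕ} (f : Vec n → Vec n) (x : Vec n) :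
    Set (Matrix (Fin n) (Fin n) ℝ) :=
  {V | ∃ (z : ℕ → Vec n) (J : ℕ → Matrix (Fin n) (Fin n) ℝ),
    Tendsto z atTop (𝓝 x) ∧
    (∀ k, HasFDerivAt f (Matrix.toEuclideanCLM (𝕜 := ℝ) (J k)) (z k)) ∧
    Tendsto J atTop (𝓝 V)}

/-- The multifunction `M` of symmetric products `Θ Q`. -/
def genJac {n : ℕ} (β ρ : ℝ) (σ : Vec n → Equiv.Perm (Fin n)) (y : Vec n) :
    Set (Matrix (Fin n) (Fin n) ℝ) :=
  {M | M.IsSymm ∧ ∃ Θ ∈ bSubdifferential (prox fun x : Vec n => β * l1 x) (S ρ y),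
    ∃ Q ∈ jacS ρ σ y, M = Θ * Q}

/-- `f` is `γ`-order semismooth on the open set `O` with respect to the multifunction `K`. The
bound `O(‖h‖^{1+γ})` is uniform over the elements of `K (x + h)`. -/
structure IsSemismoothOn {m n : ℕ} (γ : ℝ) (O : Set (Vec n)) (f : Vec n → Vec m)
    (K : Vec n → Set (Matrix (Fin m) (Fin n) ℝ)) : Prop where
  isOpen : IsOpen O
  locallyLipschitz : LocallyLipschitzOn O f
  nonempty : ∀ x ∈ O, (K x).Nonempty
  isCompact : ∀ x ∈ O, IsCompact (K x)
  upperSemicontinuous : UpperHemicontinuousOn K O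
  directionallyDifferentiable : ∀ x ∈ O, ∀ d : Vec n, ∃ L : Vec m,
    Tendsto (fun t : ℝ => t⁻¹ • (f (x + t • d) - f x)) (𝓝[>] 0) (𝓝 L)
  bound : ∀ x ∈ O, ∃ C : ℝ, ∀ᶠ h in 𝓝 (0 : Vec n), ∀ V ∈ K (x + h),
    ‖f (x + h) - f x - act V h‖ ≤ C * ‖h‖ ^ (1 + γ)

end ClusteredLasso

end

noncomputable section

namespace ClusteredLasso

/-! ### Minimizers, proximal mappings and subgradients -/

/-! The map `prox (regularizer β ρ)` is piecewise affine, and near every `y` each element of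
`genJac` at a nearby `u` is the slope of an affine piece through both `u` and `y`. The error term is
therefore exactly zero, which gives semismoothness of every order.

Two formulas expose the pieces. Soft thresholding preserves subgradients of the pairwise term, so
the proximal mapping is `softVec β ∘ S ρ` (`prox_regularizer`). By rearrangement, `S ρ` sorts `y`,
projects the sorted vector shifted by `-ρ w` onto the monotone cone, and undoes the sorting
(`S_eq`).

For the projection, `B` has a right inverse. Hence the multiplier is unique and every `B_K` has full
row rank, and `K` is admissible exactly when it lies between the support of the multiplier and the
active set. By continuity, the sets admissible near `z` are admissible at `z`
(`eventually_indexSets_subset`). For each of them the projection acts on its point as the matrix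
`kerProj n K` (`proj_cone_eq_kerProj_mulVec`). Slopes of soft thresholding behave in the same way
(`eventually_isSoftSlope`). Ties in `y` force the corresponding index into `K`, so the choice of
sorting permutation is immaterial (`mem_jacS_iff`).

All this combines in `eventually_genJac`: near `y` the values of `genJac` are contained in the value
at `y`, and the increment formula is exact. Upper semicontinuity follows at once, and compactness
holds because each value is finite. An element `Θ Q` that is symmetric is a product of commuting
orthogonal projections, hence itself an orthogonal projection; this gives both semidefiniteness
claims. -/

theorem argmin_eq_of_unique {X : Type*} [Nonempty X] {C : Set X} {φ : X → ℝ} {x : X}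
    (hx : x ∈ C) (hmin : IsMinOn φ C x) (huniq : ∀ v ∈ C, φ v ≤ φ x → v = x) :
    argmin C φ = x := by
  have h := Classical.epsilon_spec (p := fun x => x ∈ C ∧ IsMinOn φ C x) ⟨x, hx, hmin⟩
  exact huniq _ h.1 (h.2 hx)

theorem inner_eq_dotProduct {n : ℕ} (x y : Vec n) : inner ℝ x y = x.ofLp ⬝ᵥ y.ofLp := by
  simp [PiLp.inner_apply, dotProduct, mul_comm]

/-- `ξ` is a subgradient of `f` at `x`. -/
def IsSubgradient {n : ℕ} (f : Vec n → ℝ) (x ξ : Vec n) : Prop :=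
  ∀ v, f x + inner ℝ ξ (v - x) ≤ f v

theorem half_sq_norm_sub {n : ℕ} (x y v : Vec n) :
    (1 / 2) * ‖v - y‖ ^ 2 =
      (1 / 2) * ‖x - y‖ ^ 2 - inner ℝ (y - x) (v - x) + (1 / 2) * ‖v - x‖ ^ 2 := by
  have h : v - y = (v - x) - (y - x) := by abel
  rw [h, norm_sub_sq_real, norm_sub_rev x y, real_inner_comm]
  ring

/-- Expanding the square around `x` leaves the surplus `‖v - x‖² / 2`, so `x` is the only minimizer,
and the choice made by `argmin` must return it. Convexity of `f` plays no role. -/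
theorem prox_eq_of_isSubgradient {n : ℕ} {f : Vec n → ℝ} {x y : Vec n}
    (h : IsSubgradient f x (y - x)) : prox f y = x := by
  have key : ∀ v, (1 / 2) * ‖x - y‖ ^ 2 + f x + (1 / 2) * ‖v - x‖ ^ 2 ≤
      (1 / 2) * ‖v - y‖ ^ 2 + f v := fun v => by
    rw [half_sq_norm_sub x y v]; linarith [h v]
  refine argmin_eq_of_unique (Set.mem_univ _) (fun v _ => ?_) fun v _ hv => ?_
  · have := key v
    have := sq_nonneg ‖v - x‖
    simp only [Set.mem_ofPred_eq]; linarith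
  · have := key v
    have h0 : ‖v - x‖ ^ 2 ≤ 0 := by linarith
    exact sub_eq_zero.1 (norm_eq_zero.1 (pow_eq_zero_iff two_ne_zero |>.1
      (le_antisymm h0 (sq_nonneg _))))

theorem isSubgradient_of_isMinOn {n : ℕ} {f : Vec n → ℝ} (hf : ConvexOn ℝ Set.univ f)
    {x y : Vec n} (h : ∀ v, (1 / 2) * ‖x - y‖ ^ 2 + f x ≤ (1 / 2) * ‖v - y‖ ^ 2 + f v) :
    IsSubgradient f x (y - x) := by
  intro v
  -- Compare `x` with the points of the segment towards `v`, divide by `t`, and then let `t` tend to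
  -- zero.
  have key : ∀ t ∈ Set.Ioo (0 : ℝ) 1,
      0 ≤ f v - f x - inner ℝ (y - x) (v - x) + t * ((1 / 2) * ‖v - x‖ ^ 2) := by
    rintro t ⟨h0, h1⟩
    have hc := hf.2 (Set.mem_univ x) (Set.mem_univ v) (sub_nonneg.2 h1.le) h0.le
      (sub_add_cancel 1 t)
    have hm := h ((1 - t) • x + t • v)
    rw [half_sq_norm_sub x y ((1 - t) • x + t • v)] at hm
    have hd : (1 - t) • x + t • v - x = t • (v - x) := by module
    rw [hd, inner_smul_right, norm_smul, mul_pow, Real.norm_eq_abs, sq_abs] at hm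
    simp only [smul_eq_mul] at hc
    have : 0 ≤ t * (f v - f x - inner ℝ (y - x) (v - x) + t * ((1 / 2) * ‖v - x‖ ^ 2)) := by
      linarith
    exact nonneg_of_mul_nonneg_right this h0
  have hlim : Tendsto (fun t : ℝ =>
      f v - f x - inner ℝ (y - x) (v - x) + t * ((1 / 2) * ‖v - x‖ ^ 2)) (𝓝[>] 0)
      (𝓝 (f v - f x - inner ℝ (y - x) (v - x) + 0 * ((1 / 2) * ‖v - x‖ ^ 2))) :=
    (Continuous.tendsto (by fun_prop) 0).mono_left nhdsWithin_le_nhds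
  have := ge_of_tendsto hlim (Filter.mem_of_superset
    (Ioo_mem_nhdsGT (zero_lt_one (α := ℝ))) key)
  linarith

/-- Cauchy–Schwarz. It serves both the proximal mappings and the projection, whose residuals `y - x`
are monotone in `x`. -/
theorem norm_sub_le_of_monotone {n : ℕ} {x₁ x₂ y₁ y₂ : Vec n}
    (h : 0 ≤ inner ℝ ((y₁ - x₁) - (y₂ - x₂)) (x₁ - x₂)) : ‖x₁ - x₂‖ ≤ ‖y₁ - y₂‖ := by
  have h1 : (y₁ - x₁) - (y₂ - x₂) = (y₁ - y₂) - (x₁ - x₂) := by abel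
  rw [h1, inner_sub_left, real_inner_self_eq_norm_sq] at h
  have h2 := real_inner_le_norm (y₁ - y₂) (x₁ - x₂)
  by_contra! hlt
  nlinarith [norm_nonneg (y₁ - y₂)]

theorem IsSubgradient.norm_sub_le {n : ℕ} {f : Vec n → ℝ} {x₁ x₂ y₁ y₂ : Vec n}
    (h₁ : IsSubgradient f x₁ (y₁ - x₁)) (h₂ : IsSubgradient f x₂ (y₂ - x₂)) :
    ‖x₁ - x₂‖ ≤ ‖y₁ - y₂‖ := by
  apply norm_sub_le_of_monotone
  have e1 := h₁ x₂
  have e2 := h₂ x₁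
  rw [← neg_sub x₁ x₂, inner_neg_right] at e1
  rw [inner_sub_left]
  linarith

/-! ### Soft thresholding -/

/-- The clipping function of the interval `[-β, β]`. -/
def clip (β t : ℝ) : ℝ := max (-β) (min β t)

/-- Soft thresholding of a real number. -/
def softThreshold (β t : ℝ) : ℝ := t - clip β t

/-- Componentwise soft thresholding. -/
def softVec {n : ℕ} (β : ℝ) (x : Vec n) : Vec n := WithLp.toLp 2 fun i => softThreshold β (x i)

theorem abs_clip_le {β : ℝ} (hβ : 0 < β) (t : ℝ) : |clip β t| ≤ β :=
  abs_le.2 ⟨le_max_left _ _, max_le (by linarith) (min_le_left _ _)⟩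

theorem clip_of_abs_le {β t : ℝ} (h : |t| ≤ β) : clip β t = t := by
  rw [clip, min_eq_right (abs_le.1 h).2, max_eq_right (abs_le.1 h).1]

theorem clip_of_le {β t : ℝ} (hβ : 0 < β) (h : β ≤ t) : clip β t = β := by
  rw [clip, min_eq_left h, max_eq_right (by linarith)]

theorem clip_of_le_neg {β t : ℝ} (h : t ≤ -β) : clip β t = -β := by
  rw [clip, max_eq_left (min_le_of_right_le h)]

theorem clip_mono (β : ℝ) : Monotone (clip β) := fun _ _ h =>
  max_le_max_left _ (min_le_min_left _ h)

theorem softThreshold_mono {β : ℝ} (hβ : 0 < β) : Monotone (softThreshold β) := by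
  intro s t h
  simp only [softThreshold, clip]
  rcases max_cases (-β) (min β s) with h1 | h1 <;> rcases max_cases (-β) (min β t) with h2 | h2 <;>
    rcases min_cases β s with h3 | h3 <;> rcases min_cases β t with h4 | h4 <;> linarith

/-- Where the thresholded value is nonzero, the clipped value is `±β` with the same sign. This is
the equality case that makes `clip β t` a subgradient of `β |·|`. -/
theorem clip_mul_softThreshold {β : ℝ} (hβ : 0 < β) (t : ℝ) :
    clip β t * softThreshold β t = β * |softThreshold β t| := by
  rcases le_or_gt |t| β with h | h
  · simp [softThreshold, clip_of_abs_le h]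
  · rcases lt_abs.1 h with h | h
    · rw [softThreshold, clip_of_le hβ h.le, abs_of_pos (by linarith)]
    · rw [softThreshold, clip_of_le_neg (by linarith), abs_of_neg (by linarith)]; ring

theorem isSubgradient_softVec {n : ℕ} {β : ℝ} (hβ : 0 < β) (x : Vec n) :
    IsSubgradient (fun v => β * l1 v) (softVec β x) (x - softVec β x) := by
  intro v
  simp only [l1, Finset.mul_sum, inner_eq_dotProduct, dotProduct, ← Finset.sum_add_distrib]
  refine Finset.sum_le_sum fun i _ => ?_
  simp only [softVec, WithLp.ofLp_sub, Pi.sub_apply]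
  have h1 : x i - softThreshold β (x i) = clip β (x i) := by simp [softThreshold]
  rw [h1, mul_sub, clip_mul_softThreshold hβ]
  have h2 : clip β (x i) * v i ≤ β * |v i| :=
    (le_abs_self _).trans (by rw [abs_mul]; gcongr; exact abs_clip_le hβ _)
  linarith

theorem prox_l1 {n : ℕ} {β : ℝ} (hβ : 0 < β) (x : Vec n) :
    prox (fun v : Vec n => β * l1 v) x = softVec β x :=
  prox_eq_of_isSubgradient (isSubgradient_softVec hβ x)

/-! ### The pairwise difference regularizer -/

theorem pairDiff_smul {n : ℕ} {t : ℝ} (ht : 0 ≤ t) (x : Vec n) :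
    pairDiff (t • x) = t * pairDiff x := by
  simp only [pairDiff, Finset.mul_sum, PiLp.smul_apply, smul_eq_mul, ← mul_sub, abs_mul,
    abs_of_nonneg ht]

theorem convexOn_pairDiff (n : ℕ) : ConvexOn ℝ Set.univ (pairDiff (n := n)) := by
  refine ⟨convex_univ, fun x _ y _ a b ha hb _ => ?_⟩
  simp only [pairDiff, smul_eq_mul, Finset.mul_sum, ← Finset.sum_add_distrib]
  refine Finset.sum_le_sum fun i _ => Finset.sum_le_sum fun j _ => ?_
  have h : (a • x + b • y) i - (a • x + b • y) j = a * (x i - x j) + b * (y i - y j) := by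
    simp; ring
  rw [h]
  refine (abs_add_le _ _).trans_eq ?_
  rw [abs_mul, abs_mul, abs_of_nonneg ha, abs_of_nonneg hb]

/-- Thresholding and clipping are both monotone, so for each pair the two differences have the same
sign and their absolute values add up. -/
theorem pairDiff_eq_softVec_add {n : ℕ} {β : ℝ} (hβ : 0 < β) (x : Vec n) :
    pairDiff x = pairDiff (softVec β x) + pairDiff (x - softVec β x) := by
  simp only [pairDiff, ← Finset.sum_add_distrib]
  refine Finset.sum_congr rfl fun i _ => Finset.sum_congr rfl fun j _ => ?_
  have hc : ∀ k, (x - softVec β x) k = clip β (x k) := fun k => by simp [softVec, softThreshold]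
  have hs : ∀ k, x k = softThreshold β (x k) + clip β (x k) := fun k => by simp [softThreshold]
  rw [hc, hc]
  simp only [softVec]
  rcases le_total (x i) (x j) with h | h
  · have h1 := softThreshold_mono hβ h
    have h2 := clip_mono β h
    rw [abs_of_nonpos (by linarith), abs_of_nonpos (by linarith), abs_of_nonpos (by linarith)]
    linarith [hs i, hs j]
  · have h1 := softThreshold_mono hβ h
    have h2 := clip_mono β h
    rw [abs_of_nonneg (by linarith), abs_of_nonneg (by linarith), abs_of_nonneg (by linarith)]
    linarith [hs i, hs j]

/-- Positive homogeneity: testing at `2x` and at `0` forces equality in the bound at `x`. -/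
theorem isSubgradient_pairDiff_iff {n : ℕ} {ρ : ℝ} {x ξ : Vec n} :
    IsSubgradient (fun v => ρ * pairDiff v) x ξ ↔
      inner ℝ ξ x = ρ * pairDiff x ∧ ∀ v, inner ℝ ξ v ≤ ρ * pairDiff v := by
  constructor
  · intro h
    have h2 := h ((2 : ℝ) • x)
    have h0 := h ((0 : ℝ) • x)
    simp only [pairDiff_smul zero_le_two, pairDiff_smul le_rfl, inner_sub_right,
      inner_smul_right] at h2 h0
    have he : inner ℝ ξ x = ρ * pairDiff x := by linarith
    refine ⟨he, fun v => ?_⟩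
    have := h v
    simp only [inner_sub_right] at this
    linarith
  · rintro ⟨h1, h2⟩ v
    simp only [inner_sub_right]
    linarith [h2 v]

/-- The linear form of `ξ` is dominated by `ρ g` and attains it at `x`. Since `g` is additive along
`x = softVec β x + (x - softVec β x)`, it is attained at both summands. -/
theorem IsSubgradient.softVec_pairDiff {n : ℕ} {β ρ : ℝ} (hβ : 0 < β) {x ξ : Vec n}
    (h : IsSubgradient (fun v => ρ * pairDiff v) x ξ) :
    IsSubgradient (fun v => ρ * pairDiff v) (softVec β x) ξ := by
  rw [isSubgradient_pairDiff_iff] at h ⊢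
  refine ⟨le_antisymm (h.2 _) ?_, h.2⟩
  have h1 := h.2 (x - softVec β x)
  have h2 := h.1
  rw [pairDiff_eq_softVec_add hβ x] at h2
  rw [inner_sub_right] at h1
  linarith

theorem isSubgradient_regularizer {n : ℕ} {β ρ : ℝ} (hβ : 0 < β) {x y : Vec n}
    (h : IsSubgradient (fun v => ρ * pairDiff v) x (y - x)) :
    IsSubgradient (regularizer β ρ) (softVec β x) (y - softVec β x) := by
  intro v
  have h1 := h.softVec_pairDiff hβ v
  have h2 := isSubgradient_softVec hβ x v
  have h3 : y - softVec β x = (y - x) + (x - softVec β x) := by abel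
  rw [h3, inner_add_left]
  simp only [regularizer] at *
  linarith


/-! ### The difference matrix -/

/-- The left index of the `i`-th consecutive difference. -/
def lo {n : ℕ} (i : Fin (n - 1)) : Fin n := ⟨i.val, by omega⟩

/-- The right index of the `i`-th consecutive difference. -/
def hi {n : ℕ} (i : Fin (n - 1)) : Fin n := ⟨i.val + 1, by omega⟩

theorem lo_le_hi {n : ℕ} (i : Fin (n - 1)) : lo i ≤ hi i := by simp [lo, hi, Fin.le_def]

theorem diffMatrix_apply {n : ℕ} (i : Fin (n - 1)) (j : Fin n) :
    diffMatrix n i j = (if j = lo i then 1 else 0) - (if j = hi i then 1 else 0) := by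
  simp only [diffMatrix, Matrix.of_apply, lo, hi, Fin.ext_iff]
  split_ifs <;> first | omega | norm_num

theorem diffMatrix_mulVec {n : ℕ} (x : Fin n → ℝ) (i : Fin (n - 1)) :
    (diffMatrix n *ᵥ x) i = x (lo i) - x (hi i) := by
  simp [Matrix.mulVec, dotProduct, diffMatrix_apply, sub_mul, Finset.sum_sub_distrib]

theorem rel_of_consecutive {n : ℕ} {r : ℝ → ℝ → Prop} (hrefl : ∀ s, r s s)
    (htrans : ∀ s t u, r s t → r t u → r s u) (x : Fin n → ℝ) {a b : Fin n} (hab : a ≤ b)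
    (h : ∀ i : Fin (n - 1), a ≤ lo i → hi i ≤ b → r (x (lo i)) (x (hi i))) : r (x a) (x b) := by
  obtain ⟨b, hb⟩ := b
  obtain ⟨a, ha⟩ := a
  simp only [Fin.mk_le_mk] at hab
  induction b, hab using Nat.le_induction with
  | base => exact hrefl _
  | succ k hk ih =>
    refine htrans _ (x ⟨k, by omega⟩) _ (ih (by omega) fun i h1 h2 => h i h1 ?_) ?_
    · exact h2.trans (by simp)
    · exact h ⟨k, by omega⟩ (by simpa [lo] using hk) (by simp [hi])

theorem mem_cone_iff {n : ℕ} {x : Vec n} : x ∈ cone n ↔ Antitone x.ofLp := by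
  simp only [cone, Set.mem_ofPred_eq, diffMatrix_mulVec, sub_nonneg]
  refine ⟨fun h a b hab => ?_, fun h i => h (lo_le_hi i)⟩
  exact rel_of_consecutive (r := fun s t => t ≤ s) (fun s => le_rfl)
    (fun s t u h1 h2 => h2.trans h1) x.ofLp hab fun i _ _ => h i

/-- The matrix whose columns are the indicators of the initial segments; a right inverse of
`diffMatrix n`. -/
def initialSegments (n : ℕ) : Matrix (Fin n) (Fin (n - 1)) ℝ :=
  Matrix.of fun j i => if j ≤ lo i then 1 else 0

theorem diffMatrix_mul_initialSegments (n : ℕ) : diffMatrix n * initialSegments n = 1 := by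
  ext i k
  rw [Matrix.mul_apply, Matrix.one_apply]
  have := diffMatrix_mulVec (fun j => initialSegments n j k) i
  rw [Matrix.mulVec, dotProduct] at this
  rw [this]
  simp only [initialSegments, Matrix.of_apply, lo, hi, Fin.le_def, Fin.ext_iff]
  split_ifs <;> first | omega | norm_num

/-- The right inverse makes `B` injective from the left, so the rank condition in `indexSets` is
automatic. -/
theorem linearIndependent_rowsOf {n : ℕ} (K : Finset (Fin (n - 1))) :
    LinearIndependent ℝ (rowsOf n K).row := by
  have h : LinearIndependent ℝ (diffMatrix n).row := by
    rw [← Matrix.vecMul_injective_iff]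
    intro l m h
    have h' : (l ᵥ* diffMatrix n) ᵥ* initialSegments n =
        (m ᵥ* diffMatrix n) ᵥ* initialSegments n :=
      congrArg (· ᵥ* initialSegments n) h
    simpa [Matrix.vecMul_vecMul, diffMatrix_mul_initialSegments] using h'
  exact h.comp _ Subtype.val_injective

/-! ### The projection onto the cone of non-increasing vectors -/

theorem isClosed_cone (n : ℕ) : IsClosed (cone n) := by
  simp only [cone, diffMatrix_mulVec, Set.ofPred_forall]
  exact isClosed_iInter fun i => isClosed_le continuous_const (by fun_prop)

theorem cone_add_mem {n : ℕ} {x y : Vec n} (hx : x ∈ cone n) (hy : y ∈ cone n) :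
    x + y ∈ cone n := by
  rw [mem_cone_iff] at *
  exact hx.add hy

theorem cone_smul_mem {n : ℕ} {x : Vec n} (hx : x ∈ cone n) {t : ℝ} (ht : 0 ≤ t) :
    t • x ∈ cone n := by
  rw [mem_cone_iff] at *
  exact fun a b h => mul_le_mul_of_nonneg_left (hx h) ht

theorem convex_cone (n : ℕ) : Convex ℝ (cone n) := fun _ hx _ hy _ _ ha hb _ =>
  cone_add_mem (cone_smul_mem hx ha) (cone_smul_mem hy hb)

theorem zero_mem_cone (n : ℕ) : (0 : Vec n) ∈ cone n := by
  rw [mem_cone_iff]; exact fun _ _ _ => le_rfl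

theorem proj_cone_spec {n : ℕ} (z : Vec n) :
    proj (cone n) z ∈ cone n ∧
      ∀ v ∈ cone n, inner ℝ (z - proj (cone n) z) (v - proj (cone n) z) ≤ 0 := by
  obtain ⟨p, hp, hmin⟩ := exists_norm_eq_iInf_of_complete_convex ⟨0, zero_mem_cone n⟩
    (isClosed_cone n).isComplete (convex_cone n) z
  rw [norm_eq_iInf_iff_real_inner_le_zero (convex_cone n) hp] at hmin
  have key : ∀ v ∈ cone n, ‖p - z‖ ^ 2 + ‖v - p‖ ^ 2 ≤ ‖v - z‖ ^ 2 := fun v hv => by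
    have := half_sq_norm_sub p z v
    linarith [hmin v hv]
  have : proj (cone n) z = p := by
    refine argmin_eq_of_unique hp (fun v hv => ?_) fun v hv h => ?_
    · have := key v hv
      simp only [Set.mem_ofPred_eq]
      refine le_of_sq_le_sq ?_ (norm_nonneg _)
      nlinarith [sq_nonneg ‖v - p‖]
    · have := key v hv
      have h2 : ‖v - z‖ ^ 2 ≤ ‖p - z‖ ^ 2 := by gcongr
      have h0 : ‖v - p‖ ^ 2 ≤ 0 := by linarith
      exact sub_eq_zero.1 (norm_eq_zero.1 (pow_eq_zero_iff two_ne_zero |>.1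
        (le_antisymm h0 (sq_nonneg _))))
  rw [this]
  exact ⟨hp, hmin⟩

theorem norm_proj_cone_sub_le {n : ℕ} (z₁ z₂ : Vec n) :
    ‖proj (cone n) z₁ - proj (cone n) z₂‖ ≤ ‖z₁ - z₂‖ := by
  apply norm_sub_le_of_monotone
  have e1 := (proj_cone_spec z₁).2 _ (proj_cone_spec z₂).1
  have e2 := (proj_cone_spec z₂).2 _ (proj_cone_spec z₁).1
  rw [← neg_sub (proj (cone n) z₁) (proj (cone n) z₂), inner_neg_right] at e1
  rw [inner_sub_left]
  linarith

theorem continuous_proj_cone (n : ℕ) : Continuous (proj (cone n)) :=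
  (LipschitzWith.of_dist_le_mul (K := 1) fun x y => by
    simpa [dist_eq_norm] using norm_proj_cone_sub_le x y).continuous

theorem inner_sub_proj_cone_le {n : ℕ} (z : Vec n) {v : Vec n} (hv : v ∈ cone n) :
    inner ℝ (z - proj (cone n) z) v ≤ 0 := by
  have := (proj_cone_spec z).2 _ (cone_add_mem (proj_cone_spec z).1 hv)
  rwa [add_sub_cancel_left] at this

theorem inner_sub_proj_cone_self {n : ℕ} (z : Vec n) :
    inner ℝ (z - proj (cone n) z) (proj (cone n) z) = 0 := by
  refine le_antisymm (inner_sub_proj_cone_le z (proj_cone_spec z).1) ?_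
  have := (proj_cone_spec z).2 _ (zero_mem_cone n)
  rw [zero_sub, inner_neg_right] at this
  linarith

/-! ### Multipliers -/

/-- The KKT multiplier of the projection of `z` onto the cone. -/
def multiplier {n : ℕ} (z : Vec n) : Fin (n - 1) → ℝ :=
  (z - proj (cone n) z).ofLp ᵥ* initialSegments n

theorem eq_multiplier_of_mem {n : ℕ} {z : Vec n} {l : Fin (n - 1) → ℝ} (h : l ∈ multipliers z) :
    l = multiplier z := by
  have h1 : (z - proj (cone n) z).ofLp = l ᵥ* diffMatrix n := by
    have h1 := h.1
    rw [Matrix.mulVec_transpose] at h1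
    rw [WithLp.ofLp_sub]
    linear_combination -h1
  rw [multiplier, h1, Matrix.vecMul_vecMul, diffMatrix_mul_initialSegments, Matrix.vecMul_one]

/-- The residual is orthogonal to constant vectors, since these lie in the cone together with their
negatives. Modulo constants, `initialSegments n` is also a left inverse of `B`. -/
theorem multiplier_vecMul {n : ℕ} (z : Vec n) :
    multiplier z ᵥ* diffMatrix n = (z - proj (cone n) z).ofLp := by
  set u := (z - proj (cone n) z).ofLp with hu
  have hconst : ∀ c : ℝ, u ⬝ᵥ (fun _ => c) = 0 := by
    intro c
    have h1 : ∀ c : ℝ, u ⬝ᵥ (fun _ => c) ≤ 0 := fun c => by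
      have hm : (WithLp.toLp 2 (fun _ => c) : Vec n) ∈ cone n := by
        rw [mem_cone_iff]; exact fun _ _ _ => le_rfl
      have := inner_sub_proj_cone_le z hm
      rwa [inner_eq_dotProduct] at this
    refine le_antisymm (h1 c) ?_
    have := h1 (-c)
    have e : (fun _ : Fin n => -c) = -(fun _ => c) := rfl
    rw [e, dotProduct_neg] at this
    linarith
  refine dotProduct_eq _ _ fun x => ?_
  rw [multiplier, ← hu, Matrix.vecMul_vecMul, ← Matrix.dotProduct_mulVec]
  -- This vector is killed by `B`, hence constant, hence orthogonal to the residual.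
  set d := (initialSegments n * diffMatrix n) *ᵥ x - x with hd
  have hBd : ∀ i, d (lo i) = d (hi i) := fun i => by
    rw [← sub_eq_zero, ← diffMatrix_mulVec, hd, Matrix.mulVec_sub, Matrix.mulVec_mulVec,
      ← Matrix.mul_assoc, diffMatrix_mul_initialSegments, Matrix.one_mul, sub_self, Pi.zero_apply]
  have hall : ∀ a b, d a = d b := by
    have : ∀ a b, a ≤ b → d a = d b := fun a b hab =>
      rel_of_consecutive (r := (· = ·)) (fun _ => rfl) (fun _ _ _ => Eq.trans) d hab
        fun i _ _ => hBd i
    intro a b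
    rcases le_total a b with h | h
    · exact this a b h
    · exact (this b a h).symm
  have hud : u ⬝ᵥ d = 0 := by
    rcases isEmpty_or_nonempty (Fin n) with _ | ⟨⟨a⟩⟩
    · simp [dotProduct]
    · rw [show d = fun _ => d a from funext fun b => hall b a, hconst]
  have : (initialSegments n * diffMatrix n) *ᵥ x = x + d := by rw [hd]; abel
  rw [this, dotProduct_add, hud, add_zero]

/-- Each entry pairs the residual, which lies in the polar cone, with the indicator of an initial
segment, which lies in the cone. -/
theorem multiplier_nonpos {n : ℕ} (z : Vec n) (i : Fin (n - 1)) : multiplier z i ≤ 0 := by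
  have hm : (WithLp.toLp 2 (fun j => initialSegments n j i) : Vec n) ∈ cone n := by
    rw [mem_cone_iff]
    intro a b hab
    simp only [initialSegments, Matrix.of_apply]
    split_ifs with h1 h2
    · rfl
    · exact absurd (hab.trans h1) h2
    · norm_num
    · rfl
  have := inner_sub_proj_cone_le z hm
  rwa [inner_eq_dotProduct] at this

theorem multiplier_mem {n : ℕ} (z : Vec n) : multiplier z ∈ multipliers z := by
  refine ⟨?_, (proj_cone_spec z).1, multiplier_nonpos z, ?_⟩
  · rw [Matrix.mulVec_transpose, multiplier_vecMul, WithLp.ofLp_sub]; abel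
  · rw [Matrix.dotProduct_mulVec, multiplier_vecMul, ← inner_eq_dotProduct,
      inner_sub_proj_cone_self]

theorem mem_indexSets_iff {n : ℕ} {z : Vec n} {K : Finset (Fin (n - 1))} :
    K ∈ indexSets z ↔ (∀ i, multiplier z i ≠ 0 → i ∈ K) ∧ ∀ i ∈ K, i ∈ activeSet z := by
  constructor
  · rintro ⟨⟨l, hl, hsupp⟩, hact, -⟩
    rw [eq_multiplier_of_mem hl] at hsupp
    exact ⟨fun i hi => hsupp hi, fun i hi => hact hi⟩
  · rintro ⟨h1, h2⟩
    exact ⟨⟨multiplier z, multiplier_mem z, fun i hi => h1 i hi⟩, fun i hi => h2 i hi,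
      linearIndependent_rowsOf K⟩

theorem mem_activeSet_of_multiplier_ne_zero {n : ℕ} {z : Vec n} {i : Fin (n - 1)}
    (h : multiplier z i ≠ 0) : i ∈ activeSet z := by
  have hm := multiplier_mem z
  have hsum := hm.2.2.2
  rw [dotProduct, Finset.sum_eq_zero_iff_of_nonpos
    fun i _ => mul_nonpos_of_nonpos_of_nonneg (hm.2.2.1 i) (hm.2.1 i)] at hsum
  exact (mul_eq_zero.1 (hsum i (Finset.mem_univ i))).resolve_left h

open Classical in
theorem activeSet_mem_indexSets {n : ℕ} (z : Vec n) :
    (activeSet z).toFinset ∈ indexSets z := by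
  rw [mem_indexSets_iff]
  exact ⟨fun i hi => by simpa using mem_activeSet_of_multiplier_ne_zero hi, fun i hi => by
    simpa using hi⟩

theorem continuous_multiplier {n : ℕ} (i : Fin (n - 1)) :
    Continuous fun z : Vec n => multiplier z i := by
  have := continuous_proj_cone n
  simp only [multiplier, Matrix.vecMul, dotProduct]
  fun_prop

/-- Nonzero multiplier entries stay nonzero and inactive constraints stay inactive, so near `z` the
requirements on `K` are at least as strict as at `z`. -/
theorem eventually_indexSets_subset {n : ℕ} (z : Vec n) :
    ∀ᶠ z' in 𝓝 z, indexSets z' ⊆ indexSets z := by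
  have hm : ∀ᶠ z' in 𝓝 z, ∀ i, multiplier z i ≠ 0 → multiplier z' i ≠ 0 := by
    refine eventually_all.2 fun i => ?_
    by_cases h : multiplier z i = 0
    · simp [h]
    · exact ((continuous_multiplier i).continuousAt.eventually_ne h).mono fun _ h _ => h
  have ha : ∀ᶠ z' in 𝓝 z, ∀ i, i ∉ activeSet z → i ∉ activeSet z' := by
    refine eventually_all.2 fun i => ?_
    by_cases h : i ∈ activeSet z
    · simp [h]
    · have hc : Continuous fun z : Vec n => (diffMatrix n *ᵥ (proj (cone n) z).ofLp) i := by
        have := continuous_proj_cone n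
        simp only [diffMatrix_mulVec]
        fun_prop
      exact (hc.continuousAt.eventually_ne h).mono fun _ h _ => h
  filter_upwards [hm, ha] with z' h1 h2 K hK
  rw [mem_indexSets_iff] at hK ⊢
  exact ⟨fun i hi => hK.1 i (h1 i hi), fun i hi => by_contra fun hn => h2 i hn (hK.2 i hi)⟩

theorem diffMatrix_mulVec_row_nonpos {n : ℕ} {i k : Fin (n - 1)} (h : i ≠ k) :
    (diffMatrix n *ᵥ (diffMatrix n k)) i ≤ 0 := by
  have h' : i.val ≠ k.val := fun e => h (Fin.ext e)
  rw [diffMatrix_mulVec]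
  simp only [diffMatrix, Matrix.of_apply, lo, hi]
  split_ifs <;> first | omega | norm_num

/-- The off-diagonal entries of `B Bᵀ` and the multiplier are nonpositive. If the `i`-th entry of
the multiplier vanished, `(B z)_i` would be a sum of nonnegative terms. -/
theorem multiplier_ne_zero_of_lt {n : ℕ} {z : Vec n} {i : Fin (n - 1)}
    (h : z (lo i) < z (hi i)) : multiplier z i ≠ 0 := by
  intro h0
  have h1 : z.ofLp = (proj (cone n) z).ofLp + multiplier z ᵥ* diffMatrix n := by
    rw [multiplier_vecMul, WithLp.ofLp_sub]; abel
  have h2 : (diffMatrix n *ᵥ z.ofLp) i = (diffMatrix n *ᵥ (proj (cone n) z).ofLp) i +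
      ∑ k, multiplier z k * (diffMatrix n *ᵥ (diffMatrix n k)) i := by
    conv_lhs => rw [h1]
    rw [Matrix.mulVec_add, Pi.add_apply, Matrix.vecMul_eq_sum, Matrix.mulVec_sum]
    simp [Matrix.mulVec_smul]
  have h3 : 0 ≤ ∑ k, multiplier z k * (diffMatrix n *ᵥ (diffMatrix n k)) i := by
    refine Finset.sum_nonneg fun k _ => ?_
    by_cases hk : i = k
    · subst hk; simp [h0]
    · exact mul_nonneg_of_nonpos_of_nonpos (multiplier_nonpos z k) (diffMatrix_mulVec_row_nonpos hk)
  have h4 := (proj_cone_spec z).1 i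
  rw [diffMatrix_mulVec] at h2
  linarith


/-! ### Permutations and the proximal mapping of the pairwise differences -/

/-- The vector with permuted entries. -/
def permVec {n : ℕ} (τ : Equiv.Perm (Fin n)) (x : Vec n) : Vec n := WithLp.toLp 2 (x.ofLp ∘ τ)

theorem act_permMatrix {n : ℕ} (τ : Equiv.Perm (Fin n)) (y : Vec n) :
    act (τ.permMatrix ℝ) y = permVec τ y := by
  rw [act, Matrix.permMatrix_mulVec, permVec]

theorem permVec_permVec_symm {n : ℕ} (τ : Equiv.Perm (Fin n)) (x : Vec n) :
    permVec τ (permVec τ.symm x) = x := by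
  ext i; simp [permVec]

theorem permVec_sub {n : ℕ} (τ : Equiv.Perm (Fin n)) (x y : Vec n) :
    permVec τ (x - y) = permVec τ x - permVec τ y := rfl

theorem norm_permVec {n : ℕ} (τ : Equiv.Perm (Fin n)) (x : Vec n) : ‖permVec τ x‖ = ‖x‖ := by
  rw [EuclideanSpace.norm_eq, EuclideanSpace.norm_eq]
  congr 1
  exact Equiv.sum_comp τ fun i => ‖x i‖ ^ 2

theorem continuous_permVec {n : ℕ} (τ : Equiv.Perm (Fin n)) : Continuous (permVec τ) := by
  unfold permVec
  simp only [Function.comp_def]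
  fun_prop

theorem two_mul_pairDiff {n : ℕ} (x : Vec n) : 2 * pairDiff x = ∑ i, ∑ j, |x i - x j| := by
  have h : ∀ i, ∑ j, |x i - x j| = ∑ j ∈ {i}ᶜ, |x j - x i| := fun i => by
    rw [← Finset.sum_add_sum_compl {i}]
    simp [abs_sub_comm]
  simp only [h]
  rw [← Finset.sum_sum_Ioi_add_eq_sum_sum_off_diag (fun i j => |x i - x j|), pairDiff,
    Finset.mul_sum]
  refine Finset.sum_congr rfl fun i _ => ?_
  rw [Finset.mul_sum]
  refine Finset.sum_congr rfl fun j _ => ?_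
  rw [abs_sub_comm (x j)]; ring

theorem pairDiff_permVec {n : ℕ} (τ : Equiv.Perm (Fin n)) (x : Vec n) :
    pairDiff (permVec τ x) = pairDiff x := by
  have h : 2 * pairDiff (permVec τ x) = 2 * pairDiff x := by
    rw [two_mul_pairDiff, two_mul_pairDiff, ← Equiv.sum_comp τ fun i => ∑ j, |x i - x j|]
    exact Finset.sum_congr rfl fun i _ => Equiv.sum_comp τ fun j => |x (τ i) - x j|
  linarith

/-- On the cone `g` is linear: the entry at zero-based index `i` has sign plus against the `n - 1 -
i` later ones and sign minus against the `i` earlier ones. -/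
theorem pairDiff_of_antitone {n : ℕ} {x : Vec n} (hx : Antitone x.ofLp) :
    pairDiff x = inner ℝ (weight n) x := by
  have h1 : pairDiff x = ∑ i, ∑ j ∈ Finset.Ioi i, x i - ∑ i, ∑ j ∈ Finset.Ioi i, x j := by
    rw [pairDiff, ← Finset.sum_sub_distrib]
    refine Finset.sum_congr rfl fun i _ => ?_
    rw [← Finset.sum_sub_distrib]
    refine Finset.sum_congr rfl fun j hj => ?_
    rw [abs_of_nonneg]
    exact sub_nonneg.2 (hx (Finset.mem_Ioi.1 hj).le)
  have h2 : ∑ i, ∑ j ∈ Finset.Ioi i, x j = ∑ j, ∑ i ∈ Finset.Iio j, x j :=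
    Finset.sum_comm' (by simp)
  rw [h1, h2, inner_eq_dotProduct, dotProduct, ← Finset.sum_sub_distrib]
  refine Finset.sum_congr rfl fun i _ => ?_
  rw [Finset.sum_const, Finset.sum_const, Fin.card_Ioi, Fin.card_Iio, nsmul_eq_mul, nsmul_eq_mul,
    Nat.sub_sub, Nat.cast_sub (by omega)]
  simp only [weight]
  push_cast
  ring

theorem exists_antitone_permVec {n : ℕ} (v : Vec n) :
    ∃ τ : Equiv.Perm (Fin n), Antitone (permVec τ v).ofLp :=
  ⟨Tuple.sort (-v.ofLp), fun a b h => by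
    have := Tuple.monotone_sort (-v.ofLp) h
    simpa [permVec] using this⟩

theorem norm_sub_permVec_le {n : ℕ} {y v : Vec n} {τ : Equiv.Perm (Fin n)} (hy : Antitone y.ofLp)
    (hv : Antitone (permVec τ v).ofLp) : ‖permVec τ v - y‖ ≤ ‖v - y‖ := by
  have h := (hy.monovary hv).sum_mul_comp_perm_le_sum_mul (σ := τ.symm)
  have h1 : inner ℝ v y ≤ inner ℝ (permVec τ v) y := by
    rw [real_inner_comm, real_inner_comm y, inner_eq_dotProduct, inner_eq_dotProduct]
    simpa [permVec, dotProduct] using h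
  refine le_of_sq_le_sq ?_ (norm_nonneg _)
  rw [norm_sub_sq_real, norm_sub_sq_real, norm_permVec]
  linarith

/-- Sorting a competitor keeps `g` and does not increase the distance to the sorted `y`. On the
cone, completing the square turns the objective into half the squared distance to `y - ρ w` plus a
constant. -/
theorem isMinOn_of_antitone {n : ℕ} {ρ : ℝ} {y : Vec n} (hy : Antitone y.ofLp) (v : Vec n) :
    (1 / 2) * ‖proj (cone n) (y - ρ • weight n) - y‖ ^ 2 +
        ρ * pairDiff (proj (cone n) (y - ρ • weight n)) ≤
      (1 / 2) * ‖v - y‖ ^ 2 + ρ * pairDiff v := by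
  set z := y - ρ • weight n with hz
  have hform : ∀ x : Vec n, Antitone x.ofLp → (1 / 2) * ‖x - y‖ ^ 2 + ρ * pairDiff x =
      (1 / 2) * ‖x - z‖ ^ 2 + ((1 / 2) * ‖y‖ ^ 2 - (1 / 2) * ‖z‖ ^ 2) := fun x hx => by
    have hyz : y = z + ρ • weight n := by rw [hz]; abel
    have h1 : inner ℝ x y = inner ℝ x z + ρ * inner ℝ (weight n) x := by
      conv_lhs => rw [hyz]
      rw [inner_add_right, inner_smul_right, real_inner_comm x (weight n)]
    rw [pairDiff_of_antitone hx, norm_sub_sq_real, norm_sub_sq_real, h1]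
    ring
  obtain ⟨τ, hτ⟩ := exists_antitone_permVec v
  have hp := proj_cone_spec z
  have h1 : ‖proj (cone n) z - z‖ ^ 2 ≤ ‖permVec τ v - z‖ ^ 2 := by
    have := half_sq_norm_sub (proj (cone n) z) z (permVec τ v)
    have := hp.2 _ (mem_cone_iff.2 hτ)
    nlinarith [sq_nonneg ‖permVec τ v - proj (cone n) z‖]
  calc _ = _ := hform _ (mem_cone_iff.1 hp.1)
    _ ≤ (1 / 2) * ‖permVec τ v - z‖ ^ 2 + ((1 / 2) * ‖y‖ ^ 2 - (1 / 2) * ‖z‖ ^ 2) := by linarith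
    _ = (1 / 2) * ‖permVec τ v - y‖ ^ 2 + ρ * pairDiff (permVec τ v) := (hform _ hτ).symm
    _ ≤ _ := by
      rw [pairDiff_permVec]
      gcongr
      exact norm_sub_permVec_le hy hτ

theorem isSubgradient_permVec_symm_proj_cone {n : ℕ} {ρ : ℝ} (hρ : 0 < ρ) {y : Vec n} {τ : Equiv.Perm (Fin n)}
    (hτ : Antitone (permVec τ y).ofLp) :
    IsSubgradient (fun v => ρ * pairDiff v)
      (permVec τ.symm (proj (cone n) (permVec τ y - ρ • weight n)))
      (y - permVec τ.symm (proj (cone n) (permVec τ y - ρ • weight n))) := by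
  refine isSubgradient_of_isMinOn ?_ fun v => ?_
  · simpa using (convexOn_pairDiff n).smul hρ.le
  · have h := isMinOn_of_antitone (ρ := ρ) hτ (permVec τ v)
    rw [pairDiff_permVec, ← permVec_sub, norm_permVec] at h
    rw [pairDiff_permVec, ← norm_permVec τ, permVec_sub, permVec_permVec_symm]
    exact h

theorem S_eq {n : ℕ} {ρ : ℝ} (hρ : 0 < ρ) {y : Vec n} {τ : Equiv.Perm (Fin n)}
    (hτ : Antitone (permVec τ y).ofLp) :
    S ρ y = permVec τ.symm (proj (cone n) (permVec τ y - ρ • weight n)) :=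
  prox_eq_of_isSubgradient (isSubgradient_permVec_symm_proj_cone hρ hτ)

theorem isSubgradient_S {n : ℕ} {ρ : ℝ} (hρ : 0 < ρ) (y : Vec n) :
    IsSubgradient (fun v => ρ * pairDiff v) (S ρ y) (y - S ρ y) := by
  obtain ⟨τ, hτ⟩ := exists_antitone_permVec y
  rw [S_eq hρ hτ]
  exact isSubgradient_permVec_symm_proj_cone hρ hτ

theorem prox_regularizer {n : ℕ} {β ρ : ℝ} (hβ : 0 < β) (hρ : 0 < ρ) (y : Vec n) :
    prox (regularizer β ρ) y = softVec β (S ρ y) :=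
  prox_eq_of_isSubgradient (isSubgradient_regularizer hβ (isSubgradient_S hρ y))

theorem lipschitzWith_prox_regularizer {n : ℕ} {β ρ : ℝ} (hβ : 0 < β) (hρ : 0 < ρ) :
    LipschitzWith 1 (prox (n := n) (regularizer β ρ)) :=
  LipschitzWith.of_dist_le_mul fun x y => by
    have := (isSubgradient_regularizer hβ (isSubgradient_S hρ x)).norm_sub_le
      (isSubgradient_regularizer hβ (isSubgradient_S hρ y))
    simpa [dist_eq_norm, prox_regularizer hβ hρ] using this

theorem continuous_S {n : ℕ} {ρ : ℝ} (hρ : 0 < ρ) : Continuous (S (n := n) ρ) :=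
  (LipschitzWith.of_dist_le_mul (K := 1) fun x y => by
    simpa [dist_eq_norm] using (isSubgradient_S hρ x).norm_sub_le (isSubgradient_S hρ y)).continuous


/-! ### The B-subdifferential of soft thresholding -/

theorem hasDerivAt_softThreshold_zero {β a : ℝ} (h : |a| < β) :
    HasDerivAt (softThreshold β) 0 a := by
  refine (hasDerivAt_const a (0 : ℝ)).congr_of_eventuallyEq ?_
  filter_upwards [continuous_abs.continuousAt.eventually_lt continuousAt_const h] with t ht
  rw [softThreshold, clip_of_abs_le ht.le, sub_self]

theorem hasDerivAt_softThreshold_one {β a : ℝ} (hβ : 0 < β) (h : β < |a|) :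
    HasDerivAt (softThreshold β) 1 a := by
  rcases lt_abs.1 h with h | h
  · refine ((hasDerivAt_id a).sub_const β).congr_of_eventuallyEq ?_
    filter_upwards [eventually_gt_nhds h] with t ht
    rw [softThreshold, clip_of_le hβ ht.le, id]
  · refine ((hasDerivAt_id a).sub_const (-β)).congr_of_eventuallyEq ?_
    filter_upwards [eventually_lt_nhds (show a < -β by linarith)] with t ht
    rw [softThreshold, clip_of_le_neg ht.le, id]

/-- `c` is a generalized derivative of soft thresholding at `a`. -/
def IsSoftSlope (β a c : ℝ) : Prop := (c = 0 ∧ |a| ≤ β) ∨ (c = 1 ∧ β ≤ |a|)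

theorem isSoftSlope_of_hasDerivAt {β a c : ℝ} (hβ : 0 < β) (h : HasDerivAt (softThreshold β) c a) :
    IsSoftSlope β a c := by
  rcases le_or_gt |a| β with ha | ha
  · have hmem : a ∈ Set.Icc (-β) β := abs_le.1 ha
    -- At `|a| = β` the derivative is computed within `[-β, β]`, where the function vanishes and
    -- derivatives are unique.
    refine Or.inl ⟨(uniqueDiffOn_Icc (by linarith) a hmem).eq_deriv _ h.hasDerivWithinAt ?_, ha⟩
    refine (hasDerivWithinAt_const a _ (0 : ℝ)).congr_of_mem (fun t ht => ?_) hmem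
    rw [softThreshold, clip_of_abs_le (abs_le.2 ht), sub_self]
  · exact Or.inr ⟨h.unique (hasDerivAt_softThreshold_one hβ ha), ha.le⟩

theorem isClosed_isSoftSlope (β : ℝ) : IsClosed {p : ℝ × ℝ | IsSoftSlope β p.1 p.2} := by
  have h1 : IsClosed {p : ℝ × ℝ | p.2 = 0 ∧ |p.1| ≤ β} :=
    (isClosed_eq continuous_snd continuous_const).inter
      (isClosed_le continuous_fst.abs continuous_const)
  have h2 : IsClosed {p : ℝ × ℝ | p.2 = 1 ∧ β ≤ |p.1|} :=
    (isClosed_eq continuous_snd continuous_const).inter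
      (isClosed_le continuous_const continuous_fst.abs)
  exact h1.union h2

theorem hasFDerivAt_softVec_apply {n : ℕ} {β : ℝ} {J : Matrix (Fin n) (Fin n) ℝ} {z : Vec n}
    (h : HasFDerivAt (softVec β) (Matrix.toEuclideanCLM (𝕜 := ℝ) J) z) (i j : Fin n) :
    HasDerivAt (fun t : ℝ => softThreshold β (z i + (t - z j) * if i = j then 1 else 0))
      (J i j) (z j) := by
  have hline : HasDerivAt (fun t : ℝ => z + (t - z j) • EuclideanSpace.single j (1 : ℝ))
      (EuclideanSpace.single j 1) (z j) := by
    simpa using (((hasDerivAt_id (z j)).sub_const (z j)).smul_const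
      (EuclideanSpace.single j (1 : ℝ))).const_add z
  have hz : z + (z j - z j) • EuclideanSpace.single j (1 : ℝ) = z := by simp
  have h' := HasFDerivAt.comp_hasDerivAt (z j) (by rw [hz]; exact h) hline
  have h'' := (EuclideanSpace.proj (𝕜 := ℝ) i).hasFDerivAt.comp_hasDerivAt (z j) h'
  refine (h''.congr_deriv ?_).congr_of_eventuallyEq (Eventually.of_forall fun t => ?_)
  · simp
  · simp [softVec]

theorem mem_bSubdifferential_softVec_iff {n : ℕ} {β : ℝ} (hβ : 0 < β) {η : Vec n}
    {V : Matrix (Fin n) (Fin n) ℝ} :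
    V ∈ bSubdifferential (softVec β) η ↔
      ∃ θ : Fin n → ℝ, V = Matrix.diagonal θ ∧ ∀ i, IsSoftSlope β (η i) (θ i) := by
  constructor
  · rintro ⟨z, J, hz, hJ, hlim⟩
    refine ⟨fun i => V i i, ?_, fun i => ?_⟩
    · ext i j
      rw [Matrix.diagonal_apply]
      split_ifs with hij
      · rw [hij]
      · have h0 : ∀ k, J k i j = 0 := fun k => by
          have := hasFDerivAt_softVec_apply (hJ k) i j
          simp only [hij, if_false, mul_zero, add_zero] at this
          exact this.unique (hasDerivAt_const _ _)
        have hl : Tendsto (fun k => J k i j) atTop (𝓝 (V i j)) :=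
          ((continuous_apply_apply i j).tendsto V).comp hlim
        simp only [h0] at hl
        exact tendsto_nhds_unique hl tendsto_const_nhds
    · have hl : Tendsto (fun k => J k i i) atTop (𝓝 (V i i)) :=
        ((continuous_apply_apply i i).tendsto V).comp hlim
      have hz' : Tendsto (fun k => z k i) atTop (𝓝 (η i)) :=
        ((show Continuous fun x : Vec n => x i by fun_prop).tendsto η).comp hz
      refine (isClosed_isSoftSlope β).mem_of_tendsto (hz'.prodMk_nhds hl)
        (Eventually.of_forall fun k => isSoftSlope_of_hasDerivAt hβ ?_)
      simpa using hasFDerivAt_softVec_apply (hJ k) i i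
  · rintro ⟨θ, rfl, hθ⟩
    -- Scaling the coordinate `η i` by `1 - ε` or `1 + ε`, according to `θ i`, moves it strictly to
    -- the required side of the kink. The second `+ 1` keeps `ε < 1`, so the factor is positive from
    -- the first term on.
    set ε : ℕ → ℝ := fun k => 1 / ((k : ℝ) + 1 + 1) with hε
    have hε0 : ∀ k, 0 < ε k ∧ ε k < 1 := fun k =>
      ⟨by positivity, by rw [hε, div_lt_one (by positivity)]; linarith [k.cast_nonneg (α := ℝ)]⟩
    refine ⟨fun k => WithLp.toLp 2 fun i => (1 + (2 * θ i - 1) * ε k) * η i,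
      fun _ => Matrix.diagonal θ, ?_, fun k => ?_, tendsto_const_nhds⟩
    · have hlim : Tendsto ε atTop (𝓝 0) := by
        have := (tendsto_add_atTop_iff_nat 1).2 (tendsto_one_div_add_atTop_nhds_zero_nat (𝕜 := ℝ))
        simpa [hε] using this
      have hc : Continuous fun t : ℝ =>
          (WithLp.toLp 2 fun i => (1 + (2 * θ i - 1) * t) * η i : Vec n) := by fun_prop
      have := (hc.tendsto 0).comp hlim
      simpa [Function.comp_def] using this
    · rw [← hasFDerivWithinAt_univ, hasFDerivWithinAt_euclidean]
      intro i
      rw [hasFDerivWithinAt_univ]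
      have hd : HasDerivAt (softThreshold β) (θ i) ((1 + (2 * θ i - 1) * ε k) * η i) := by
        obtain ⟨h0, h1⟩ := hε0 k
        rcases hθ i with ⟨h, hi⟩ | ⟨h, hi⟩ <;> rw [h]
        · apply hasDerivAt_softThreshold_zero
          rw [abs_mul, abs_of_pos (by linarith)]
          nlinarith [abs_nonneg (η i)]
        · apply hasDerivAt_softThreshold_one hβ
          rw [abs_mul, abs_of_pos (by linarith)]
          nlinarith [abs_nonneg (η i)]
      have hp : HasFDerivAt (fun x : Vec n => x i) (EuclideanSpace.proj (𝕜 := ℝ) i)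
          (WithLp.toLp 2 fun i => (1 + (2 * θ i - 1) * ε k) * η i) :=
        (EuclideanSpace.proj (𝕜 := ℝ) i).hasFDerivAt
      have := HasDerivAt.comp_hasFDerivAt
        (WithLp.toLp 2 fun i => (1 + (2 * θ i - 1) * ε k) * η i : Vec n) hd hp
      have hD : PiLp.proj 2 (fun _ => ℝ) i ∘L
          Matrix.toEuclideanCLM (𝕜 := ℝ) (Matrix.diagonal θ) =
          θ i • EuclideanSpace.proj (𝕜 := ℝ) i := by
        refine ContinuousLinearMap.ext fun x => ?_
        exact Matrix.mulVec_diagonal θ x.ofLp i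
      exact hD ▸ this

theorem eventually_isSoftSlope {β a : ℝ} (hβ : 0 < β) :
    ∀ᶠ b in 𝓝 a, ∀ c, IsSoftSlope β b c →
      IsSoftSlope β a c ∧ softThreshold β b - softThreshold β a = c * (b - a) := by
  have habs : ContinuousAt (fun b : ℝ => |b|) a := continuous_abs.continuousAt
  rcases lt_trichotomy |a| β with h | h | h
  · filter_upwards [habs.eventually_lt continuousAt_const h] with b hb c hc
    rcases hc with ⟨rfl, hc⟩ | ⟨rfl, hc⟩
    · refine ⟨Or.inl ⟨rfl, h.le⟩, ?_⟩
      rw [softThreshold, softThreshold, clip_of_abs_le h.le, clip_of_abs_le hb.le]; ring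
    · exact absurd hb hc.not_gt
  -- At a kink both slopes are admissible; it suffices to keep `b` on the same side of zero, so that
  -- `b` and `a` share the affine piece of either slope.
  · have hsgn : ∀ᶠ b in 𝓝 a, 0 < a * b := by
      have ha : a ≠ 0 := by rintro rfl; simp at h; linarith
      exact (continuousAt_const.mul continuousAt_id).eventually_const_lt
        (show 0 < a * id a from mul_self_pos.2 ha)
    filter_upwards [hsgn] with b hb c hc
    rcases hc with ⟨rfl, hc⟩ | ⟨rfl, hc⟩
    · refine ⟨Or.inl ⟨rfl, h.le⟩, ?_⟩
      rw [softThreshold, softThreshold, clip_of_abs_le h.le, clip_of_abs_le hc]; ring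
    · refine ⟨Or.inr ⟨rfl, h.ge⟩, ?_⟩
      rcases pos_and_pos_or_neg_and_neg_of_mul_pos hb with ⟨h1, h2⟩ | ⟨h1, h2⟩
      · rw [abs_of_pos h1] at h
        rw [abs_of_pos h2] at hc
        rw [softThreshold, softThreshold, clip_of_le hβ hc, clip_of_le hβ h.ge]; ring
      · rw [abs_of_neg h1] at h
        rw [abs_of_neg h2] at hc
        rw [softThreshold, softThreshold, clip_of_le_neg (by linarith),
          clip_of_le_neg (by linarith)]; ring
  · rcases lt_abs.1 h with h' | h'
    · filter_upwards [eventually_gt_nhds h'] with b hb c hc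
      rcases hc with ⟨rfl, hc⟩ | ⟨rfl, hc⟩
      · linarith [le_abs_self b]
      · refine ⟨Or.inr ⟨rfl, h.le⟩, ?_⟩
        rw [softThreshold, softThreshold, clip_of_le hβ hb.le, clip_of_le hβ h'.le]; ring
    · filter_upwards [eventually_lt_nhds (show a < -β by linarith)] with b hb c hc
      rcases hc with ⟨rfl, hc⟩ | ⟨rfl, hc⟩
      · linarith [neg_le_abs b]
      · refine ⟨Or.inr ⟨rfl, h.le⟩, ?_⟩
        rw [softThreshold, softThreshold, clip_of_le_neg hb.le,
          clip_of_le_neg (show a ≤ -β by linarith)]; ring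


/-! ### The HS-Jacobian -/

/-- The orthogonal projection onto the kernel of `B_K`. -/
def kerProj (n : ℕ) (K : Finset (Fin (n - 1))) : Matrix (Fin n) (Fin n) ℝ :=
  1 - (rowsOf n K)ᵀ * (rowsOf n K * (rowsOf n K)ᵀ)⁻¹ * rowsOf n K

theorem isUnit_det_gram {n : ℕ} (K : Finset (Fin (n - 1))) :
    IsUnit (rowsOf n K * (rowsOf n K)ᵀ).det := by
  have h := Matrix.PosDef.mul_conjTranspose_self (rowsOf n K)
    (Matrix.vecMul_injective_iff.2 (linearIndependent_rowsOf K))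
  rw [Matrix.conjTranspose_eq_transpose_of_trivial] at h
  exact (Matrix.isUnit_iff_isUnit_det _).1 h.isUnit

theorem rowsOf_mul_kerProj {n : ℕ} (K : Finset (Fin (n - 1))) : rowsOf n K * kerProj n K = 0 := by
  rw [kerProj, Matrix.mul_sub, Matrix.mul_one, ← Matrix.mul_assoc, ← Matrix.mul_assoc,
    Matrix.mul_nonsing_inv _ (isUnit_det_gram K), Matrix.one_mul, sub_self]

theorem kerProj_mul_of_rowsOf_mul {n : ℕ} {K : Finset (Fin (n - 1))}
    {X : Matrix (Fin n) (Fin n) ℝ} (h : rowsOf n K * X = 0) : kerProj n K * X = X := by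
  rw [kerProj, Matrix.sub_mul, Matrix.one_mul, Matrix.mul_assoc, h, Matrix.mul_zero, sub_zero]

theorem kerProj_mulVec_of_rowsOf_mulVec {n : ℕ} {K : Finset (Fin (n - 1))}
    {x : Fin n → ℝ} (h : rowsOf n K *ᵥ x = 0) : kerProj n K *ᵥ x = x := by
  rw [kerProj, Matrix.sub_mulVec, Matrix.one_mulVec, ← Matrix.mulVec_mulVec, h, Matrix.mulVec_zero,
    sub_zero]

theorem transpose_kerProj {n : ℕ} (K : Finset (Fin (n - 1))) : (kerProj n K)ᵀ = kerProj n K := by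
  simp only [kerProj, Matrix.transpose_sub, Matrix.transpose_one, Matrix.transpose_mul,
    Matrix.transpose_transpose, Matrix.transpose_nonsing_inv, Matrix.mul_assoc]

theorem kerProj_mul_self {n : ℕ} (K : Finset (Fin (n - 1))) :
    kerProj n K * kerProj n K = kerProj n K :=
  kerProj_mul_of_rowsOf_mul (rowsOf_mul_kerProj K)

theorem kerProj_mulVec_vecMul_rowsOf {n : ℕ} (K : Finset (Fin (n - 1))) (l : K → ℝ) :
    kerProj n K *ᵥ (l ᵥ* rowsOf n K) = 0 := by
  have h := congrArg Matrix.transpose (rowsOf_mul_kerProj K)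
  rw [Matrix.transpose_mul, transpose_kerProj, Matrix.transpose_zero] at h
  rw [← Matrix.mulVec_transpose, Matrix.mulVec_mulVec, h, Matrix.zero_mulVec]

theorem rowsOf_mulVec_eq_zero_iff {n : ℕ} {K : Finset (Fin (n - 1))} {x : Fin n → ℝ} :
    rowsOf n K *ᵥ x = 0 ↔ ∀ i ∈ K, x (lo i) = x (hi i) := by
  have h : ∀ k : K, (rowsOf n K *ᵥ x) k = x (lo k.1) - x (hi k.1) := fun k =>
    diffMatrix_mulVec x k.1
  simp only [funext_iff, h, Pi.zero_apply, sub_eq_zero, Subtype.forall]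

theorem kerProj_lo_eq_hi {n : ℕ} {K : Finset (Fin (n - 1))} {i : Fin (n - 1)} (hi' : i ∈ K)
    (c : Fin n) : kerProj n K (lo i) c = kerProj n K (hi i) c := by
  have h : rowsOf n K *ᵥ (fun a => kerProj n K a c) = 0 :=
    funext fun k => congrFun (congrFun (rowsOf_mul_kerProj K) k) c
  exact rowsOf_mulVec_eq_zero_iff.1 h i hi'

/-- In `z = Π_D(z) + Bᵀ λ` the last term lies in the row space of `B_K`, because `K` contains the
support of `λ`. The first term lies in the kernel of `B_K`, because `K` is active. -/
theorem proj_cone_eq_kerProj_mulVec {n : ℕ} {z : Vec n} {K : Finset (Fin (n - 1))}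
    (hK : K ∈ indexSets z) : (proj (cone n) z).ofLp = kerProj n K *ᵥ z.ofLp := by
  rw [mem_indexSets_iff] at hK
  have h1 : z.ofLp = (proj (cone n) z).ofLp + multiplier z ᵥ* diffMatrix n := by
    rw [multiplier_vecMul, WithLp.ofLp_sub]; abel
  have h2 : multiplier z ᵥ* diffMatrix n = (fun k : K => multiplier z k.1) ᵥ* rowsOf n K := by
    funext j
    simp only [Matrix.vecMul, dotProduct, rowsOf, Matrix.submatrix_apply, id]
    rw [Finset.sum_coe_sort K fun i => multiplier z i * diffMatrix n i j]
    refine (Finset.sum_subset (Finset.subset_univ K) fun i _ hi => ?_).symm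
    rw [by_contra fun h => hi (hK.1 i h), zero_mul]
  conv_rhs => rw [h1, h2]
  rw [Matrix.mulVec_add, kerProj_mulVec_vecMul_rowsOf, add_zero, kerProj_mulVec_of_rowsOf_mulVec]
  rw [rowsOf_mulVec_eq_zero_iff]
  intro i hi
  have := hK.2 i hi
  rwa [activeSet, Set.mem_ofPred_eq, diffMatrix_mulVec, sub_eq_zero] at this

/-! ### Independence of the sorting permutation -/

/-- Consecutive weights drop by `2`, so a tie in `x` becomes a strict increase of `x - ρ w`, and the
multiplier cannot vanish there. -/
theorem mem_of_tie {n : ℕ} {ρ : ℝ} (hρ : 0 < ρ) {x : Vec n} {K : Finset (Fin (n - 1))}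
    (hK : K ∈ indexSets (x - ρ • weight n)) {i : Fin (n - 1)} (h : x (lo i) = x (hi i)) : i ∈ K := by
  rw [mem_indexSets_iff] at hK
  refine hK.1 i (multiplier_ne_zero_of_lt ?_)
  simp only [PiLp.sub_apply, PiLp.smul_apply, smul_eq_mul, h]
  simp only [weight, lo, hi]
  push_cast
  nlinarith

theorem kerProj_eq_of_tie {n : ℕ} {ρ : ℝ} (hρ : 0 < ρ) {x : Vec n} (hx : Antitone x.ofLp)
    {K : Finset (Fin (n - 1))} (hK : K ∈ indexSets (x - ρ • weight n)) {a b : Fin n}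
    (hab : x a = x b) (c : Fin n) : kerProj n K a c = kerProj n K b c := by
  wlog h : a ≤ b generalizing a b
  · exact (this hab.symm (le_of_not_ge h)).symm
  refine rel_of_consecutive (r := (· = ·)) (fun _ => rfl) (fun _ _ _ => Eq.trans)
    (fun a => kerProj n K a c) h fun i h1 h2 => kerProj_lo_eq_hi (mem_of_tie hρ hK ?_) c
  refine le_antisymm ?_ (hx (lo_le_hi i))
  calc x (lo i) ≤ x a := hx h1
    _ = x b := hab
    _ ≤ x (hi i) := hx h2

/-- Two sorting permutations differ only inside blocks of ties, and on such blocks the rows and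
columns of `kerProj n K` are constant. -/
theorem kerProj_submatrix_congr {n : ℕ} {ρ : ℝ} (hρ : 0 < ρ) {y : Vec n}
    {τ₁ τ₂ : Equiv.Perm (Fin n)} (h₁ : Antitone (permVec τ₁ y).ofLp)
    (h₂ : permVec τ₁ y = permVec τ₂ y) {K : Finset (Fin (n - 1))}
    (hK : K ∈ indexSets (permVec τ₁ y - ρ • weight n)) :
    (kerProj n K).submatrix τ₁.symm τ₁.symm = (kerProj n K).submatrix τ₂.symm τ₂.symm := by
  have htie : ∀ a, permVec τ₁ y (τ₁.symm a) = permVec τ₁ y (τ₂.symm a) := fun a => by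
    conv_rhs => rw [h₂]
    simp [permVec]
  have hsymm : ∀ a b, kerProj n K a b = kerProj n K b a := fun a b =>
    congrFun (congrFun (transpose_kerProj K) b) a
  ext a b
  rw [Matrix.submatrix_apply, Matrix.submatrix_apply, kerProj_eq_of_tie hρ h₁ hK (htie a), hsymm,
    kerProj_eq_of_tie hρ h₁ hK (htie b), hsymm]

theorem transpose_permMatrix_mul_mul {n : ℕ} (τ : Equiv.Perm (Fin n))
    (Q : Matrix (Fin n) (Fin n) ℝ) :
    (τ.permMatrix ℝ)ᵀ * Q * τ.permMatrix ℝ = Q.submatrix τ.symm τ.symm := by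
  rw [Matrix.transpose_permMatrix, Equiv.Perm.permMatrix, Equiv.Perm.permMatrix,
    PEquiv.toMatrix_toPEquiv_mul, PEquiv.mul_toMatrix_toPEquiv, Matrix.submatrix_submatrix]
  rfl

/-- Frees the argument from the choice `σ`: one permutation that sorts both `u` and `y` can then be
used at both points. -/
theorem mem_jacS_iff {n : ℕ} {ρ : ℝ} (hρ : 0 < ρ) {σ : Vec n → Equiv.Perm (Fin n)}
    (hσ : IsSorting σ) {y : Vec n} {τ : Equiv.Perm (Fin n)} (hτ : Antitone (permVec τ y).ofLp)
    {Q : Matrix (Fin n) (Fin n) ℝ} :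
    Q ∈ jacS ρ σ y ↔ ∃ K ∈ indexSets (permVec τ y - ρ • weight n),
      Q = (kerProj n K).submatrix τ.symm τ.symm := by
  have hσy : Antitone (permVec (σ y) y).ofLp := by
    have := hσ y
    rwa [permMat, Matrix.permMatrix_mulVec] at this
  have heq : permVec (σ y) y = permVec τ y := by
    rw [permVec, permVec, Tuple.unique_antitone hσy hτ]
  have h : Q ∈ jacS ρ σ y ↔ ∃ K ∈ indexSets (permVec (σ y) y - ρ • weight n),
      Q = (kerProj n K).submatrix (σ y).symm (σ y).symm := by
    simp only [jacS, hsJacobian, permMat, act_permMatrix, Set.mem_ofPred_eq]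
    constructor
    · rintro ⟨Q', ⟨K, hK, rfl⟩, rfl⟩
      exact ⟨K, hK, transpose_permMatrix_mul_mul _ _⟩
    · rintro ⟨K, hK, rfl⟩
      exact ⟨_, ⟨K, hK, rfl⟩, (transpose_permMatrix_mul_mul _ _).symm⟩
  rw [h, ← heq]
  refine exists_congr fun K => and_congr_right fun hK => ?_
  rw [kerProj_submatrix_congr hρ hσy heq hK]

/-! ### The generalized Jacobian -/

theorem S_eq_kerProj_mulVec {n : ℕ} {ρ : ℝ} (hρ : 0 < ρ) {y : Vec n} {τ : Equiv.Perm (Fin n)}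
    (hτ : Antitone (permVec τ y).ofLp) {K : Finset (Fin (n - 1))}
    (hK : K ∈ indexSets (permVec τ y - ρ • weight n)) :
    (S ρ y).ofLp = (kerProj n K *ᵥ (permVec τ y - ρ • weight n).ofLp) ∘ τ.symm := by
  rw [S_eq hρ hτ, permVec, proj_cone_eq_kerProj_mulVec hK]

theorem S_sub_S {n : ℕ} {ρ : ℝ} (hρ : 0 < ρ) {u y : Vec n} {τ : Equiv.Perm (Fin n)}
    (hu : Antitone (permVec τ u).ofLp) (hy : Antitone (permVec τ y).ofLp)
    {K : Finset (Fin (n - 1))} (hKu : K ∈ indexSets (permVec τ u - ρ • weight n))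
    (hKy : K ∈ indexSets (permVec τ y - ρ • weight n)) :
    S ρ u - S ρ y = act ((kerProj n K).submatrix τ.symm τ.symm) (u - y) := by
  ext a
  rw [PiLp.sub_apply, S_eq_kerProj_mulVec hρ hu hKu, S_eq_kerProj_mulVec hρ hy hKy, act,
    Matrix.submatrix_mulVec_equiv, Function.comp_apply, Function.comp_apply]
  change _ = (kerProj n K *ᵥ ((u - y).ofLp ∘ τ.symm.symm)) (τ.symm a)
  have h : (permVec τ u - ρ • weight n).ofLp - (permVec τ y - ρ • weight n).ofLp =
      (u - y).ofLp ∘ τ.symm.symm := by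
    funext b; simp [permVec]
  rw [← Pi.sub_apply, ← Matrix.mulVec_sub, h]

/-- There are finitely many permutations, and being sorted by a given one is a closed condition; one
that fails at `y` fails nearby. -/
theorem eventually_sorting {n : ℕ} (ρ : ℝ) (y : Vec n) :
    ∀ᶠ u in 𝓝 y, ∀ τ : Equiv.Perm (Fin n), Antitone (permVec τ u).ofLp →
      Antitone (permVec τ y).ofLp ∧
      indexSets (permVec τ u - ρ • weight n) ⊆ indexSets (permVec τ y - ρ • weight n) := by
  refine eventually_all.2 fun τ => ?_
  by_cases hy : Antitone (permVec τ y).ofLp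
  · have hc : Continuous fun u : Vec n => permVec τ u - ρ • weight n :=
      (continuous_permVec τ).sub continuous_const
    exact ((hc.tendsto y).eventually (eventually_indexSets_subset _)).mono fun u h _ => ⟨hy, h⟩
  · have hopen : IsOpen {u : Vec n | ¬ Antitone (permVec τ u).ofLp} := by
      simp only [← mem_cone_iff]
      exact ((isClosed_cone n).preimage (continuous_permVec τ)).isOpen_compl
    exact (hopen.eventually_mem hy).mono fun u hu h => absurd h hu

variable {n : ℕ} {β ρ : ℝ} {σ : Vec n → Equiv.Perm (Fin n)}

theorem mem_genJac_iff (hβ : 0 < β) (hρ : 0 < ρ) (hσ : IsSorting σ) {y : Vec n}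
    {τ : Equiv.Perm (Fin n)} (hτ : Antitone (permVec τ y).ofLp) {M : Matrix (Fin n) (Fin n) ℝ} :
    M ∈ genJac β ρ σ y ↔ M.IsSymm ∧ ∃ θ : Fin n → ℝ, (∀ i, IsSoftSlope β (S ρ y i) (θ i)) ∧
      ∃ K ∈ indexSets (permVec τ y - ρ • weight n),
        M = Matrix.diagonal θ * (kerProj n K).submatrix τ.symm τ.symm := by
  have hprox : (prox fun x : Vec n => β * l1 x) = softVec β := funext (prox_l1 hβ)
  rw [genJac, hprox]
  simp only [Set.mem_ofPred_eq, mem_bSubdifferential_softVec_iff hβ, mem_jacS_iff hρ hσ hτ]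
  refine and_congr_right fun _ => ?_
  constructor
  · rintro ⟨_, ⟨θ, rfl, hθ⟩, _, ⟨K, hK, rfl⟩, rfl⟩
    exact ⟨θ, hθ, K, hK, rfl⟩
  · rintro ⟨θ, hθ, K, hK, rfl⟩
    exact ⟨_, ⟨θ, rfl, hθ⟩, _, ⟨K, hK, rfl⟩, rfl⟩

theorem eventually_genJac (hβ : 0 < β) (hρ : 0 < ρ) (hσ : IsSorting σ) (y : Vec n) :
    ∀ᶠ u in 𝓝 y, ∀ M ∈ genJac β ρ σ u, M ∈ genJac β ρ σ y ∧
      prox (regularizer β ρ) u - prox (regularizer β ρ) y = act M (u - y) := by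
  have hS : ∀ᶠ u in 𝓝 y, ∀ i, ∀ c, IsSoftSlope β (S ρ u i) c → IsSoftSlope β (S ρ y i) c ∧
      softThreshold β (S ρ u i) - softThreshold β (S ρ y i) = c * (S ρ u i - S ρ y i) := by
    refine eventually_all.2 fun i => ?_
    have hc : Continuous fun u : Vec n => S ρ u i := by
      have := continuous_S (n := n) hρ
      fun_prop
    exact (hc.tendsto y).eventually (eventually_isSoftSlope hβ)
  filter_upwards [hS, eventually_sorting ρ y] with u h1 h2 M hM
  obtain ⟨τ, hτ⟩ := exists_antitone_permVec u
  obtain ⟨hsymm, θ, hθ, K, hK, rfl⟩ := (mem_genJac_iff hβ hρ hσ hτ).1 hM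
  obtain ⟨hτy, hsub⟩ := h2 τ hτ
  refine ⟨(mem_genJac_iff hβ hρ hσ hτy).2
    ⟨hsymm, θ, fun i => (h1 i _ (hθ i)).1, K, hsub hK, rfl⟩, ?_⟩
  have hdiff := S_sub_S hρ hτ hτy hK (hsub hK)
  rw [prox_regularizer hβ hρ, prox_regularizer hβ hρ]
  ext i
  have hi : S ρ u i - S ρ y i =
      ((kerProj n K).submatrix τ.symm τ.symm *ᵥ (u - y).ofLp) i := by
    rw [← PiLp.sub_apply, hdiff, act]
  rw [act, ← Matrix.mulVec_mulVec]
  change _ = (Matrix.diagonal θ *ᵥ _) i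
  rw [Matrix.mulVec_diagonal, ← hi]
  exact (h1 i _ (hθ i)).2

theorem genJac_nonempty (hβ : 0 < β) (hρ : 0 < ρ) (hσ : IsSorting σ) (y : Vec n) :
    (genJac β ρ σ y).Nonempty := by
  classical
  obtain ⟨τ, hτ⟩ := exists_antitone_permVec y
  set z := permVec τ y - ρ • weight n with hz
  set K := (activeSet z).toFinset with hKdef
  have hK : K ∈ indexSets z := activeSet_mem_indexSets z
  set slope : ℝ → ℝ := fun a => if |a| ≤ β then 0 else 1 with hslope
  have hsl : ∀ a, IsSoftSlope β a (slope a) := fun a => by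
    by_cases h : |a| ≤ β
    · exact Or.inl ⟨if_pos h, h⟩
    · exact Or.inr ⟨if_neg h, (not_le.1 h).le⟩
  set d : Fin n → ℝ := fun a => slope (proj (cone n) z a) with hd
  have hSy : ∀ a, slope (S ρ y a) = d (τ.symm a) := fun a => by rw [S_eq hρ hτ, permVec]; rfl
  refine ⟨_, (mem_genJac_iff hβ hρ hσ hτ).2 ⟨?_, fun a => slope (S ρ y a), fun a => hsl _, K, hK,
    rfl⟩⟩
  -- The slope is chosen as a function of the value, and the projection agrees across every index of
  -- the active set `K`. The diagonal matrix therefore preserves the kernel of `B_K`, so the product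
  -- equals `Q D Q` with `Q` the kernel projection, which is symmetric.
  have h0 : rowsOf n K * (Matrix.diagonal d * kerProj n K) = 0 := by
    ext k c
    have hcol : rowsOf n K *ᵥ (fun a => (Matrix.diagonal d * kerProj n K) a c) = 0 := by
      rw [rowsOf_mulVec_eq_zero_iff]
      intro i hiK
      have hact : proj (cone n) z (lo i) = proj (cone n) z (hi i) := by
        have := (mem_indexSets_iff.1 hK).2 i hiK
        rwa [activeSet, Set.mem_ofPred_eq, diffMatrix_mulVec, sub_eq_zero] at this
      simp only [Matrix.diagonal_mul, hd, hact, kerProj_lo_eq_hi hiK c]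
    exact congrFun hcol k
  have h1 := kerProj_mul_of_rowsOf_mul h0
  have h2 : (Matrix.diagonal d * kerProj n K).IsSymm := by
    rw [Matrix.IsSymm, ← h1]
    simp only [Matrix.transpose_mul, transpose_kerProj, Matrix.diagonal_transpose, Matrix.mul_assoc]
  have h3 : Matrix.diagonal (fun a => slope (S ρ y a)) * (kerProj n K).submatrix τ.symm τ.symm =
      (Matrix.diagonal d * kerProj n K).submatrix τ.symm τ.symm := by
    ext a b
    rw [Matrix.diagonal_mul, Matrix.submatrix_apply, Matrix.submatrix_apply, Matrix.diagonal_mul,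
      hSy]
  rw [h3]
  exact h2.submatrix _

theorem genJac_finite (hβ : 0 < β) (hρ : 0 < ρ) (hσ : IsSorting σ) (y : Vec n) :
    (genJac β ρ σ y).Finite := by
  obtain ⟨τ, hτ⟩ := exists_antitone_permVec y
  refine (Set.finite_range fun p : Set (Fin n) × Finset (Fin (n - 1)) =>
    Matrix.diagonal (p.1.indicator fun _ => (1 : ℝ)) *
      (kerProj n p.2).submatrix τ.symm τ.symm).subset fun M hM => ?_
  obtain ⟨-, θ, hθ, K, -, rfl⟩ := (mem_genJac_iff hβ hρ hσ hτ).1 hM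
  refine ⟨({i | θ i = 1}, K), ?_⟩
  have : Set.indicator {i | θ i = 1} (fun _ => (1 : ℝ)) = θ := by
    funext i
    rcases hθ i with h | h <;> simp [h.1]
  simp only [this]

theorem genJac_mul_self (hβ : 0 < β) (hρ : 0 < ρ) (hσ : IsSorting σ) {y : Vec n}
    {M : Matrix (Fin n) (Fin n) ℝ} (hM : M ∈ genJac β ρ σ y) : M * M = M := by
  obtain ⟨τ, hτ⟩ := exists_antitone_permVec y
  obtain ⟨hsymm, θ, hθ, K, -, rfl⟩ := (mem_genJac_iff hβ hρ hσ hτ).1 hM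
  set Q := (kerProj n K).submatrix τ.symm τ.symm with hQ
  have hQt : Qᵀ = Q := by rw [hQ, Matrix.transpose_submatrix, transpose_kerProj]
  have hQQ : Q * Q = Q := by
    rw [hQ, Matrix.submatrix_mul_equiv, kerProj_mul_self]
  have hD : Matrix.diagonal θ * Matrix.diagonal θ = Matrix.diagonal θ := by
    rw [Matrix.diagonal_mul_diagonal]
    congr 1
    funext i
    rcases hθ i with h | h <;> simp [h.1]
  have hcomm : Q * Matrix.diagonal θ = Matrix.diagonal θ * Q := by
    -- Symmetry of a product of two symmetric matrices says that they commute.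
    have := hsymm.eq
    rwa [Matrix.transpose_mul, Matrix.diagonal_transpose, hQt] at this
  calc Matrix.diagonal θ * Q * (Matrix.diagonal θ * Q)
      = Matrix.diagonal θ * (Q * Matrix.diagonal θ) * Q := by simp only [Matrix.mul_assoc]
    _ = (Matrix.diagonal θ * Matrix.diagonal θ) * (Q * Q) := by
      rw [hcomm]; simp only [Matrix.mul_assoc]
    _ = _ := by rw [hD, hQQ]

theorem posSemidef_of_isSymm_of_mul_self {M : Matrix (Fin n) (Fin n) ℝ} (hs : M.IsSymm)
    (hM : M * M = M) : M.PosSemidef := by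
  have h := Matrix.posSemidef_conjTranspose_mul_self M
  rwa [Matrix.conjTranspose_eq_transpose_of_trivial, hs.eq, hM] at h

theorem upperHemicontinuous_genJac (hβ : 0 < β) (hρ : 0 < ρ) (hσ : IsSorting σ) :
    UpperHemicontinuous (genJac β ρ σ) := by
  rw [upperHemicontinuous_iff]
  intro y
  rw [upperHemicontinuousAt_iff]
  intro t ht
  filter_upwards [eventually_genJac hβ hρ hσ y] with u hu
  exact nhdsSet_mono (fun M hM => (hu M hM).1) ht

/-- A continuous map from an interval into a finite set is constant, by connectedness. -/
theorem tendsto_of_finite_range {f : ℝ → Vec n} (hf : ContinuousOn f (Set.Ioi 0)) {s : Set (Vec n)}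
    (hs : s.Finite) (h : ∀ᶠ t in 𝓝[>] 0, f t ∈ s) : ∃ L, Tendsto f (𝓝[>] 0) (𝓝 L) := by
  obtain ⟨ε, hε, hsub⟩ := mem_nhdsGT_iff_exists_Ioo_subset.1 h
  have hε' : (0 : ℝ) < ε := hε
  have hpre : IsPreconnected (f '' Set.Ioo 0 ε) :=
    isPreconnected_Ioo.image f (hf.mono Set.Ioo_subset_Ioi_self)
  have hsing : (f '' Set.Ioo 0 ε).Subsingleton :=
    hs.countable.isTotallyDisconnected _ (Set.image_subset_iff.2 hsub) hpre
  have hmem : ε / 2 ∈ Set.Ioo 0 ε := ⟨by linarith, by linarith⟩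
  refine ⟨f (ε / 2), tendsto_const_nhds.congr' ?_⟩
  filter_upwards [Ioo_mem_nhdsGT hε'] with t ht
  exact hsing ⟨_, hmem, rfl⟩ ⟨_, ht, rfl⟩

theorem act_smul {m : ℕ} (A : Matrix (Fin m) (Fin n) ℝ) (t : ℝ) (x : Vec n) :
    act A (t • x) = t • act A x := by
  rw [act, act, WithLp.ofLp_smul, Matrix.mulVec_smul, WithLp.toLp_smul]

theorem directionally_differentiable (hβ : 0 < β) (hρ : 0 < ρ) (hσ : IsSorting σ)
    (y d : Vec n) : ∃ L : Vec n, Tendsto (fun t : ℝ => t⁻¹ • (prox (regularizer β ρ) (y + t • d) -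
      prox (regularizer β ρ) y)) (𝓝[>] 0) (𝓝 L) := by
  -- For small `t > 0` the difference quotient is `M d` for some `M` in the finite set `genJac β ρ σ
  -- y`.
  refine tendsto_of_finite_range (s := (fun M => act M d) '' genJac β ρ σ y) ?_
    ((genJac_finite hβ hρ hσ y).image _) ?_
  · have hc := (lipschitzWith_prox_regularizer (n := n) hβ hρ).continuous
    refine ContinuousOn.smul (continuousOn_inv₀.mono fun t ht => ht.ne') ?_
    exact Continuous.continuousOn (by fun_prop)
  · have hline : Tendsto (fun t : ℝ => y + t • d) (𝓝[>] 0) (𝓝 y) := by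
      have hc : Continuous fun t : ℝ => y + t • d := by fun_prop
      simpa using (hc.tendsto 0).mono_left nhdsWithin_le_nhds
    filter_upwards [hline.eventually (eventually_genJac hβ hρ hσ y), self_mem_nhdsWithin]
      with t ht ht0
    obtain ⟨M, hM⟩ := genJac_nonempty hβ hρ hσ (y + t • d)
    obtain ⟨h1, h2⟩ := ht M hM
    refine ⟨M, h1, ?_⟩
    rw [h2, add_sub_cancel_left, act_smul, inv_smul_smul₀ (ne_of_gt ht0)]

theorem isSemismoothOn_prox_regularizer (hβ : 0 < β) (hρ : 0 < ρ) (hσ : IsSorting σ) (γ : ℝ) :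
    IsSemismoothOn γ Set.univ (prox (regularizer β ρ)) (genJac β ρ σ) where
  isOpen := isOpen_univ
  locallyLipschitz := (lipschitzWith_prox_regularizer hβ hρ).locallyLipschitz.locallyLipschitzOn
  nonempty y _ := genJac_nonempty hβ hρ hσ y
  isCompact y _ := (genJac_finite hβ hρ hσ y).isCompact
  upperSemicontinuous := (upperHemicontinuous_genJac hβ hρ hσ).upperHemicontinuousOn _
  directionallyDifferentiable y _ d := directionally_differentiable hβ hρ hσ y d
  bound y _ := by
    -- The constant `0` works because the increment formula is exact, whatever the order `γ`.
    refine ⟨0, ?_⟩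
    have hshift : Tendsto (fun h : Vec n => y + h) (𝓝 0) (𝓝 y) := by
      simpa using (continuous_const_add y).tendsto 0
    filter_upwards [hshift.eventually (eventually_genJac hβ hρ hσ y)] with h hh V hV
    rw [(hh V hV).2, add_sub_cancel_left, sub_self, norm_zero, zero_mul]

end ClusteredLasso

end

theorem mainTheorem3 (n : ℕ) (β ρ : ℝ) (hβ : 0 < β) (hρ : 0 < ρ)
    (σ : ClusteredLasso.Vec n → Equiv.Perm (Fin n)) (hσ : ClusteredLasso.IsSorting σ) :
    (∀ y, (ClusteredLasso.genJac β ρ σ y).Nonempty) ∧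
    (∀ y, IsCompact (ClusteredLasso.genJac β ρ σ y)) ∧
    UpperHemicontinuous (ClusteredLasso.genJac β ρ σ) ∧
    (∀ y, ∀ M ∈ ClusteredLasso.genJac β ρ σ y,
      M.IsSymm ∧ M.PosSemidef ∧ (1 - M).IsSymm ∧ (1 - M).PosSemidef) ∧
    (∀ y, ∃ Y ∈ nhds y, ∀ u ∈ Y, ∀ M ∈ ClusteredLasso.genJac β ρ σ u,
      ClusteredLasso.prox (ClusteredLasso.regularizer β ρ) u
        - ClusteredLasso.prox (ClusteredLasso.regularizer β ρ) y
        - ClusteredLasso.act M (u - y) = 0) ∧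
    (∀ γ : ℝ, 0 < γ → ClusteredLasso.IsSemismoothOn γ Set.univ
      (ClusteredLasso.prox (ClusteredLasso.regularizer β ρ))
      (ClusteredLasso.genJac β ρ σ)) := by
  refine ⟨ClusteredLasso.genJac_nonempty hβ hρ hσ,
    fun y => (ClusteredLasso.genJac_finite hβ hρ hσ y).isCompact,
    ClusteredLasso.upperHemicontinuous_genJac hβ hρ hσ, fun y M hM => ?_, fun y => ?_,
    fun γ _ => ClusteredLasso.isSemismoothOn_prox_regularizer hβ hρ hσ γ⟩
  · have hMM := ClusteredLasso.genJac_mul_self hβ hρ hσ hM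
    have hs : (1 - M).IsSymm := Matrix.isSymm_one.sub hM.1
    refine ⟨hM.1, ClusteredLasso.posSemidef_of_isSymm_of_mul_self hM.1 hMM, hs,
      ClusteredLasso.posSemidef_of_isSymm_of_mul_self hs ?_⟩
    rw [Matrix.sub_mul, Matrix.mul_sub, Matrix.mul_sub, hMM]
    simp
  · exact ⟨_, ClusteredLasso.eventually_genJac hβ hρ hσ y, fun u hu M hM =>
      sub_eq_zero.2 (hu M hM).2⟩
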